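/- Let $l\ge 3$ and let $C_l$ be the cycle with $l$ vertices. For $r\ge 3$ let $C_l^{(r)}$ be the $r$-uniform hypercycle of length $l$, i.e. the hypergraph obtained from $C_l$ by adding $r-2$ new vertices to each edge (distinct edges receiving disjoint sets of new vertices). Let $\mathcal A=(a_{i_1\cdots i_r})$ be its adjacency tensor, indexed by the vertices of $C_l^{(r)}$: $a_{i_1\cdots i_r}=\frac1{(r-1)!}$ if $\{i_1,\dots,i_r\}$ is an edge, and $0$ otherwise. A number $\lambda\in\mathbb C$ is an eigenvalue of $C_l^{(r)}$, written $\lambda\in\operatorname{Spec}(C_l^{(r)})$, if there is a nonzero complex vector $x$ with $\sum_{i_2,\dots,i_r}a_{i i_2\cdots i_r}x_{i_2}\cdots x_{i_r}=\lambda x_i^{r-1}$ for every vertex $i$. Write $[n]=\{1,\dots,n\}$. Then: (1) for every $r\ge 4$, $$\{\lambda^r:\lambda\in\operatorname{Spec}(C_l^{(r)})\}=\{4\}\cup\Big\{\Big(2\cos\frac{k\pi}{j+1}\Big)^2:\ k\in[j],\ j\in[l]\Big\};$$ (2) for $r=3$, $$\{\lambda^3:\lambda\in\operatorname{Spec}(C_l^{(3)})\}=\{4\}\cup\Big\{\Big(2\cos\frac{k\pi}{j+1}\Big)^2:\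 k\in[j],\ j\in[l-1]\Big\}.$$ -/

import Mathlib

/-- Complex tensors of order `r` indexed by `V` (dimension `|V|`). The entry `a_{i i₂ … i_r}` is
written `A i α`, with first index `i` and remaining indices `α = (i₂, …, i_r)`. -/
abbrev ComplexTensor (r : ℕ) (V : Type*) := V → (Fin (r - 1) → V) → ℂ

namespace ComplexTensor

/-- The vector `A x`, `(A x)_i = ∑_{i₂, …, i_r} a_{i i₂ … i_r} x_{i₂} ⋯ x_{i_r}`. -/
noncomputable def apply {r : ℕ} {V : Type*} [Fintype V] (A : ComplexTensor r V) (x : V → ℂ) :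
    V → ℂ :=
  fun i => ∑ α : Fin (r - 1) → V, A i α * ∏ s, x (α s)

/-- `(μ, x)` is an eigenpair of `A`: `x` is a nonzero complex vector and
`(A x)_i = μ x_i ^ (r - 1)` for every `i`. -/
def IsEigenpair {r : ℕ} {V : Type*} [Fintype V] (A : ComplexTensor r V) (μ : ℂ) (x : V → ℂ) :
    Prop :=
  x ≠ 0 ∧ ∀ i, A.apply x i = μ * x i ^ (r - 1)

/-- The set of eigenvalues of `A`. -/
def eigenvalues {r : ℕ} {V : Type*} [Fintype V] (A : ComplexTensor r V) : Set ℂ :=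
  {μ | ∃ x : V → ℂ, A.IsEigenpair μ x}

end ComplexTensor

open Classical in
/-- The adjacency tensor of an `r`-uniform hypergraph whose vertex set is all of `V`:
`a_{i₁ … i_r} = 1 / (r - 1)!` if `{i₁, …, i_r}` is an edge, and `0` otherwise. -/
noncomputable def Hypergraph.adjTensor {V : Type*} (H : Hypergraph V) (r : ℕ) :
    ComplexTensor r V :=
  fun i α => if insert i (Set.range α) ∈ H.edgeSet then 1 / ((r - 1).factorial : ℂ) else 0

/-- Vertices of the `r`-power of `G`: the vertices of `G`, and `r - 2` new vertices for each edge
of `G`. -/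
abbrev SimpleGraph.PowerVertex {V : Type*} (G : SimpleGraph V) (r : ℕ) :=
  V ⊕ (G.edgeSet × Fin (r - 2))

/-- The edge of the `r`-power of `G` obtained from the edge `e` of `G`: the two ends of `e`
together with the `r - 2` new vertices belonging to `e`. -/
def SimpleGraph.powerEdge {V : Type*} (G : SimpleGraph V) (r : ℕ) (e : G.edgeSet) :
    Set (G.PowerVertex r) :=
  {w | (∃ v ∈ (e : Sym2 V), w = Sum.inl v) ∨ ∃ t : Fin (r - 2), w = Sum.inr (e, t)}

/-- The `r`-power hypergraph of a graph `G`, for `r ≥ 2`. -/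
def SimpleGraph.powerHypergraph {V : Type*} (G : SimpleGraph V) (r : ℕ) :
    Hypergraph (G.PowerVertex r) where
  vertexSet := Set.univ
  edgeSet := Set.range (G.powerEdge r)
  subset_vertexSet_of_mem_edgeSet' := fun _ _ => Set.subset_univ _

/-- The `r`-uniform hypercycle of length `l`, for `l ≥ 3` and `r ≥ 2`: the `r`-power of the cycle
of length `l`. -/
abbrev hypercycle (l r : ℕ) : Hypergraph ((SimpleGraph.cycleGraph l).PowerVertex r) :=
  (SimpleGraph.cycleGraph l).powerHypergraph r

/-- The complex numbers `(2 cos (k π / (j + 1)))²` with `1 ≤ j ≤ m` and `1 ≤ k ≤ j`. -/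
def pathSquares (m : ℕ) : Set ℂ :=
  {z | ∃ j ∈ Finset.Icc 1 m, ∃ k ∈ Finset.Icc 1 j,
    z = (((2 * Real.cos ((k : ℝ) * Real.pi / ((j : ℝ) + 1))) ^ 2 : ℝ) : ℂ)}

/-! Let `r = d + 2` and let `x` be an eigenvector for `c ≠ 0`. On the cycle put `Y i = x i ^ r`, and
let `Q i` be the product of `x` over the `i`-th hyperedge, divided by `c`. Multiplying each equation
by its own coordinate gives `Q i + Q (i + 1) = Y (i + 1)` and `Q i ^ 2 * c ^ r = Y i * Y (i + 1)`.
The latter can fail only if `Q i = 0` and `r ≥ 4`: two vanishing new vertices switch an edge off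
while its ends stay nonzero (`edge_eq_of_eigen`).

With `s ^ 2 = c ^ r`, wherever `Q` does not vanish `Y` is proportional to the square of a solution
of `z (n + 2) = s * z (n + 1) - z n`. If no `Q` vanishes, one turn multiplies `z` by a sign;
otherwise a stretch between zeros of `Q` is a path on `j` vertices with `z` zero at both ends.
Either way `s = t + t⁻¹` with `t` a root of unity (`sq_mem_of_cycle_solution`). The case `j = l`
needs one switched-off edge with nonzero ends, hence `r ≥ 4`.

Conversely, solutions of the reduced system lift to eigenvectors (`pow_mem_of_cycle_solution`):
constant `Y` gives 4, squared sine vectors of paths give the nonzero cosine values. -/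

open Finset in
/-- There are `n!` maps from `Fin n` onto a finset with `n` elements. -/
theorem card_image_univ_eq {V : Type*} [Fintype V] [DecidableEq V] {n : ℕ} (f : Finset V)
    (hf : f.card = n) :
    (univ.filter fun α : Fin n → V => univ.image α = f).card = n.factorial := by
  have hinj : ∀ α : Fin n → V, univ.image α = f → Function.Injective α := fun α h => by
    have hc : (univ.image α).card = (univ : Finset (Fin n)).card := by rw [h, hf]; simp
    simpa [Set.injOn_univ] using Finset.card_image_iff.1 hc
  rw [← Fintype.card_subtype]
  have e : {α : Fin n → V // univ.image α = f} ≃ (Fin n ≃ f) :=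
    { toFun := fun α => Equiv.ofBijective
        (fun s => ⟨α.1 s, α.2.le (mem_image_of_mem _ (mem_univ s))⟩)
        ⟨fun s t h => hinj α.1 α.2 (congrArg Subtype.val h), fun ⟨w, hw⟩ => by
          obtain ⟨s, -, rfl⟩ := mem_image.1 (α.2.ge hw)
          exact ⟨s, rfl⟩⟩
      invFun := fun g => ⟨fun s => g s, by
        ext w
        simp only [mem_image, mem_univ, true_and]
        constructor
        · rintro ⟨s, rfl⟩
          exact (g s).2
        · exact fun hw => ⟨g.symm ⟨w, hw⟩, by simp⟩⟩
      left_inv := fun α => rfl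
      right_inv := fun g => by ext; rfl }
  rw [Fintype.card_congr e, Fintype.card_equiv ((Fintype.equivFinOfCardEq (by simp [hf])).symm),
    Fintype.card_fin]

-- By counting: `α` takes at most `n` values, so they must be exactly the elements of `e` other than
-- `v`.
open Finset in
theorem insert_image_eq_iff {V : Type*} [DecidableEq V] {n : ℕ} (e : Finset V) (v : V)
    (he : e.card = n + 1) (α : Fin n → V) :
    insert v (univ.image α) = e ↔ v ∈ e ∧ univ.image α = e.erase v := by
  constructor
  · intro h
    have hv : v ∈ e := h ▸ mem_insert_self _ _
    refine ⟨hv, ?_⟩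
    have hsub : e.erase v ⊆ univ.image α := by
      rw [← h]
      exact erase_insert_subset _ _
    refine (eq_of_subset_of_card_le hsub ?_).symm
    rw [card_erase_of_mem hv, he]
    exact card_image_le.trans (by simp)
  · rintro ⟨hv, h⟩
    rw [h, insert_erase hv]

open Finset in
theorem sum_prod_insert_image {V : Type*} [Fintype V] [DecidableEq V] {n : ℕ} (e : Finset V)
    (v : V) (he : e.card = n + 1) (x : V → ℂ) :
    ∑ α : Fin n → V, (if insert v (univ.image α) = e then 1 / (n.factorial : ℂ) else 0) *
        ∏ s, x (α s) =
      if v ∈ e then ∏ w ∈ e.erase v, x w else 0 := by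
  simp only [insert_image_eq_iff e v he]
  split_ifs with hv
  · have hc : (e.erase v).card = n := by rw [card_erase_of_mem hv, he]; rfl
    have key : ∀ α : Fin n → V,
        (if v ∈ e ∧ univ.image α = e.erase v then 1 / (n.factorial : ℂ) else 0) * ∏ s, x (α s) =
        if univ.image α = e.erase v then 1 / (n.factorial : ℂ) * ∏ w ∈ e.erase v, x w else 0 := by
      intro α
      by_cases h : univ.image α = e.erase v
      · have hinj : Function.Injective α := by
          have : (univ.image α).card = (univ : Finset (Fin n)).card := by rw [h, hc]; simp
          simpa [Set.injOn_univ] using Finset.card_image_iff.1 this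
        rw [if_pos ⟨hv, h⟩, if_pos h, ← h, prod_image (fun a _ b _ hab => hinj hab)]
      · rw [if_neg (fun hh => h hh.2), if_neg h, zero_mul]
    rw [sum_congr rfl fun α _ => key α, ← sum_filter, sum_const, card_image_univ_eq _ hc,
      nsmul_eq_mul, ← mul_assoc, mul_one_div_cancel, one_mul]
    exact_mod_cast n.factorial_ne_zero
  · exact sum_eq_zero fun α _ => by rw [if_neg fun hh => hv hh.1, zero_mul]

open Finset in
/-- The adjacency tensor of an `r`-uniform hypergraph with edges `F i`, applied to a vector. -/
theorem Hypergraph.adjTensor_apply {V ι : Type*} [Fintype V] [DecidableEq V] [Fintype ι]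
    (H : Hypergraph V) {r : ℕ} (hr : 1 ≤ r) (F : ι → Finset V) (hF : Function.Injective F)
    (hcard : ∀ i, (F i).card = r) (hH : H.edgeSet = Set.range fun i => (F i : Set V))
    (x : V → ℂ) (v : V) :
    (H.adjTensor r).apply x v = ∑ i, if v ∈ F i then ∏ w ∈ (F i).erase v, x w else 0 := by
  classical
  have hA : ∀ α : Fin (r - 1) → V, H.adjTensor r v α =
      ∑ i, if insert v (univ.image α) = F i then 1 / ((r - 1).factorial : ℂ) else 0 := by
    intro α
    have hmem : insert v (Set.range α) ∈ H.edgeSet ↔ ∃ i, insert v (univ.image α) = F i := by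
      rw [hH, Set.mem_range]
      refine exists_congr fun i => ?_
      rw [← Finset.coe_inj, Finset.coe_insert, Finset.coe_image, Finset.coe_univ, Set.image_univ]
      exact eq_comm
    unfold Hypergraph.adjTensor
    by_cases h : ∃ i, insert v (univ.image α) = F i
    · obtain ⟨i, hi⟩ := h
      rw [if_pos (hmem.2 ⟨i, hi⟩), sum_eq_single i, if_pos hi]
      · exact fun j _ hj => if_neg fun hj' => hj (hF (hj'.symm.trans hi))
      · simp
    · rw [if_neg (mt hmem.1 h)]
      exact (sum_eq_zero fun i _ => if_neg fun hi => h ⟨i, hi⟩).symm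
  unfold ComplexTensor.apply
  simp only [hA, sum_mul]
  rw [sum_comm]
  exact sum_congr rfl fun i _ =>
    sum_prod_insert_image (F i) v (by rw [hcard]; omega) x

/-! ### Three-term recurrences and roots of unity. -/

/-- Sums `t + t⁻¹` with `t` a root of unity of order dividing `2 N`. -/
theorem sq_mem_of_pow_eq_one {t s : ℂ} {N m : ℕ} (hN : 1 ≤ N) (hm : N ≤ m + 1)
    (ht : t ^ (2 * N) = 1) (hs : s = t + t⁻¹) : s ^ 2 ∈ ({4} : Set ℂ) ∪ pathSquares m := by
  have hN0 : (N : ℂ) ≠ 0 := by exact_mod_cast (by omega : N ≠ 0)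
  have : NeZero (2 * N) := ⟨by omega⟩
  obtain ⟨k, hk, rfl⟩ := (Complex.isPrimitiveRoot_exp (2 * N) (by omega)).eq_pow_of_pow_eq_one ht
  have hs' : s = 2 * Complex.cos (k * Real.pi / N) := by
    rw [hs, Complex.two_cos, ← Complex.exp_nat_mul, ← Complex.exp_neg]
    congr 2 <;> push_cast <;> field_simp
  have main : ∀ k : ℕ, 1 ≤ k → k < N →
      (2 * Complex.cos (k * Real.pi / N)) ^ 2 ∈ ({4} : Set ℂ) ∪ pathSquares m := by
    intro k h1 h2
    refine Or.inr ⟨N - 1, Finset.mem_Icc.2 ⟨by omega, by omega⟩, k,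
      Finset.mem_Icc.2 ⟨h1, by omega⟩, ?_⟩
    rw [Nat.cast_sub hN]
    push_cast
    simp
  rcases Nat.eq_zero_or_pos k with rfl | h0
  · left
    rw [hs']
    norm_num
  rcases lt_trichotomy k N with h | rfl | h
  · rw [hs']
    exact main k h0 h
  · left
    rw [hs', mul_div_cancel_left₀ _ hN0, Complex.cos_pi]
    norm_num
  · have : Complex.cos (k * Real.pi / N) = -Complex.cos ((k - N : ℕ) * Real.pi / N) := by
      rw [← Complex.cos_add_pi]
      congr 1
      rw [Nat.cast_sub h.le]
      field_simp
      ring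
    rw [hs', this, mul_neg, neg_sq]
    exact main (k - N) (by omega) (by omega)

theorem exists_add_inv_eq (s : ℂ) : ∃ t : ℂ, t ≠ 0 ∧ s = t + t⁻¹ := by
  obtain ⟨d, hd⟩ := IsAlgClosed.exists_pow_nat_eq (s ^ 2 - 4) (n := 2) (by norm_num)
  have h : (s + d) / 2 * ((s - d) / 2) = 1 := by linear_combination (-1 / 4) * hd
  refine ⟨(s + d) / 2, left_ne_zero_of_mul_eq_one h, ?_⟩
  rw [← eq_inv_of_mul_eq_one_right h]
  ring

/-- The first differences of a solution of `z (n + 2) = (t + t⁻¹) z (n + 1) - z n`. -/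
theorem recurrence_sub_eq {t : ℂ} (ht : t ≠ 0) {N : ℕ} {z : ℕ → ℂ}
    (hz : ∀ n, n + 2 ≤ N → z (n + 2) = (t + t⁻¹) * z (n + 1) - z n) (n : ℕ) (hn : n + 1 ≤ N) :
    z (n + 1) - t * z n = (t⁻¹) ^ n * (z 1 - t * z 0) := by
  induction n with
  | zero => simp
  | succ n ih =>
    rw [hz n hn, pow_succ', mul_assoc, ← ih (by omega)]
    field_simp
    ring

/-- Eigenvalues of a path: a solution vanishing at both ends. -/
theorem sq_mem_of_dirichlet {s : ℂ} {N m : ℕ} (hN : 1 ≤ N) (hm : N ≤ m + 1) {z : ℕ → ℂ}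
    (hz : ∀ n, n + 2 ≤ N → z (n + 2) = s * z (n + 1) - z n) (h0 : z 0 = 0) (h1 : z 1 ≠ 0)
    (hzN : z N = 0) : s ^ 2 ∈ ({4} : Set ℂ) ∪ pathSquares m := by
  obtain ⟨t, ht, rfl⟩ := exists_add_inv_eq s
  obtain ⟨n, rfl⟩ : ∃ n, N = n + 1 := ⟨N - 1, by omega⟩
  have e1 := recurrence_sub_eq ht hz n le_rfl
  -- The recurrence is symmetric in `t` and `t⁻¹`; eliminating `z n` from the two relations leaves
  -- `t ^ (2 * N) = 1`.
  have e2 := recurrence_sub_eq (inv_ne_zero ht) (z := z)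
    (fun n hn => by rw [inv_inv, add_comm t⁻¹]; exact hz n hn) n le_rfl
  rw [hzN, h0] at e1 e2
  rw [inv_inv] at e2
  refine sq_mem_of_pow_eq_one hN hm ?_ rfl
  refine mul_right_cancel₀ h1 ?_
  have hn : t ^ n ≠ 0 := pow_ne_zero _ ht
  rw [inv_pow] at e1
  field_simp at e1 e2
  linear_combination (-t) * t ^ n * e2 + e1

/-- Eigenvalues of a signed cycle: a periodic or antiperiodic solution. -/
theorem sq_mem_of_periodic {s : ℂ} {N m : ℕ} (hN : 1 ≤ N) (hm : N ≤ m + 1) {z : ℕ → ℂ} {ε : ℂ}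
    (hε : ε ^ 2 = 1) (hz : ∀ n, z (n + 2) = s * z (n + 1) - z n) (h0 : z 0 ≠ 0)
    (hzN : ∀ n, z (n + N) = ε * z n) : s ^ 2 ∈ ({4} : Set ℂ) ∪ pathSquares m := by
  obtain ⟨t, ht, rfl⟩ := exists_add_inv_eq s
  refine sq_mem_of_pow_eq_one hN hm ?_ rfl
  have e1 := recurrence_sub_eq ht (N := N + 1) (fun n _ => hz n) N le_rfl
  have h1 := hzN 0
  have h2 := hzN 1
  rw [zero_add] at h1
  rw [add_comm] at h2
  rw [h1, h2] at e1
  have htN : t ^ N ≠ 0 := pow_ne_zero _ ht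
  -- Either `z` is geometric with ratio `t`, or `z (n + 1) - t * z n` is a nonzero geometric
  -- sequence with ratio `t⁻¹`.
  suffices h : t ^ N = ε ∨ (t⁻¹) ^ N = ε by
    rcases h with h | h
    · rw [mul_comm, pow_mul, h, hε]
    · rw [mul_comm, pow_mul, ← inv_inv (t ^ N), ← inv_pow, h, inv_pow, hε, inv_one]
  by_cases hw : z 1 - t * z 0 = 0
  · left
    have hpow : ∀ n, z n = t ^ n * z 0 := by
      intro n
      induction n with
      | zero => simp
      | succ n ih =>
        have := recurrence_sub_eq ht (N := n + 1) (fun n _ => hz n) n le_rfl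
        rw [hw, mul_zero, ih] at this
        linear_combination this
    exact mul_right_cancel₀ h0 ((hpow N).symm.trans h1)
  · right
    refine mul_right_cancel₀ hw ?_
    linear_combination -e1

/-! ### The reduced system on a cycle. -/

/-- A closed weighted walk of length `l`: vertex weights `Y`, edge weights `Q`. If `p` holds, edges
may be switched off. -/
theorem sq_mem_of_cycle_solution {l m : ℕ} {p : Prop} (hl : 2 ≤ l)
    (hm : m = l ∨ ¬ p ∧ m = l - 1) {μ : ℂ} (hμ : μ ≠ 0) {Y Q : ℕ → ℂ}
    (hY : ∀ n, Y (n + l) = Y n) (hQ : ∀ n, Q (n + l) = Q n)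
    (hsum : ∀ n, Q n + Q (n + 1) = Y (n + 1))
    (hprod : ∀ n, Q n ^ 2 * μ = Y n * Y (n + 1) ∨ p ∧ Q n = 0) (hne : ∃ n, Y n ≠ 0) :
    μ ∈ ({4} : Set ℂ) ∪ pathSquares m := by
  obtain ⟨s, hs⟩ := IsAlgClosed.exists_pow_nat_eq μ (n := 2) (by norm_num)
  have hprod' : ∀ n, Q n ≠ 0 → Q n ^ 2 * μ = Y n * Y (n + 1) := fun n h =>
    (hprod n).resolve_right fun h' => h h'.2
  have hYne : ∀ n, Q n ≠ 0 → Y n ≠ 0 ∧ Y (n + 1) ≠ 0 := fun n h =>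
    mul_ne_zero_iff.1 (hprod' n h ▸ mul_ne_zero (pow_ne_zero 2 h) hμ)
  -- Following the ratio `s * Q n / Y n` from a value `w` at `n` produces solutions of the linear
  -- recurrence.
  have hstep : ∀ n, Q n ≠ 0 → ∀ w : ℂ,
      s * (Q (n + 1) / Y (n + 1)) * (s * (Q n / Y n) * w) = s * (s * (Q n / Y n) * w) - w := by
    intro n h w
    obtain ⟨h1, h2⟩ := hYne n h
    have h3 := hprod' n h
    have h4 := hsum n
    field_simp
    rw [hs]
    linear_combination Q n * w * μ * h4 - w * h3
  rw [← hs]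
  by_cases hall : ∀ n, Q n ≠ 0
  · obtain ⟨z, z0, zs⟩ : ∃ z : ℕ → ℂ, z 0 = 1 ∧ ∀ n, z (n + 1) = s * (Q n / Y n) * z n :=
      ⟨fun n => Nat.rec 1 (fun n w => s * (Q n / Y n) * w) n, rfl, fun _ => rfl⟩
    have hsq : ∀ n, z n ^ 2 * Y 0 = Y n := by
      intro n
      induction n with
      | zero => simp [z0]
      | succ n ih =>
        have h1 := (hYne n (hall n)).1
        have h3 := hprod' n (hall n)
        rw [zs, mul_pow, mul_assoc, ih, mul_pow, div_pow, hs]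
        field_simp
        linear_combination h3
    have hper : ∀ n, z (n + l) = z l * z n := by
      intro n
      induction n with
      | zero => simp [z0]
      | succ n ih =>
        rw [show n + 1 + l = n + l + 1 by omega, zs, zs, ih, hY, hQ]
        ring
    have h0 := (hYne 0 (hall 0)).1
    refine sq_mem_of_periodic (N := l) (z := z) (ε := z l) (by omega) (by omega) ?_ ?_ ?_ hper
    · refine mul_right_cancel₀ h0 ?_
      rw [hsq, one_mul, ← hY 0, zero_add]
    · intro n
      rw [zs (n + 1), zs n, hstep n (hall n)]
    · simp [z0]
  · push Not at hall
    obtain ⟨e, he⟩ := hall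
    have hYmul : ∀ k n, Y (n + l * k) = Y n := by
      intro k
      induction k with
      | zero => simp
      | succ k ih => exact fun n => by rw [mul_add_one, ← add_assoc, hY, ih]
    -- Walk on from the zero edge `e` to the first nonzero vertex: the edge entering it is `e`
    -- itself or leaves a zero vertex.
    obtain ⟨a, hQa, hYa⟩ : ∃ a, Q a = 0 ∧ Y (a + 1) ≠ 0 := by
      have hex : ∃ i, Y (e + 1 + i) ≠ 0 := by
        obtain ⟨n, hn⟩ := hne
        refine ⟨n + l * (e + 1) - (e + 1), ?_⟩
        have : e + 1 ≤ l * (e + 1) := Nat.le_mul_of_pos_left _ (by omega)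
        rwa [show e + 1 + (n + l * (e + 1) - (e + 1)) = n + l * (e + 1) by omega, hYmul]
      classical
      obtain ⟨i, hi, hmin⟩ : ∃ i, Y (e + 1 + i) ≠ 0 ∧ ∀ k < i, Y (e + 1 + k) = 0 :=
        ⟨Nat.find hex, Nat.find_spec hex, fun k hk => not_not.1 (Nat.find_min hex hk)⟩
      refine ⟨e + i, ?_, by rwa [show e + i + 1 = e + 1 + i by omega]⟩
      rcases i with _ | i
      · exact he
      · by_contra h
        exact (hYne _ h).1 (by rw [← hmin i (by omega)]; congr 1; omega)
    obtain ⟨j, hj1, hjl, hQj, hmin⟩ : ∃ j, 1 ≤ j ∧ j ≤ l ∧ Q (a + j) = 0 ∧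
        ∀ k, 1 ≤ k → k < j → Q (a + k) ≠ 0 := by
      have hex : ∃ j, 1 ≤ j ∧ Q (a + j) = 0 := ⟨l, by omega, by rw [hQ, hQa]⟩
      classical
      exact ⟨Nat.find hex, (Nat.find_spec hex).1, Nat.find_min' hex ⟨by omega, by rw [hQ, hQa]⟩,
        (Nat.find_spec hex).2, fun k h1 h2 h3 => Nat.find_min hex h2 ⟨h1, h3⟩⟩
    have hjm : j ≤ m := by
      rcases hm with rfl | ⟨hp, rfl⟩
      · exact hjl
      · rcases hjl.lt_or_eq with h | rfl
        · omega
        -- If `j = l`, the edge `a` is the only one with weight zero and both its ends are nonzero,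
        -- so it must be switched off.
        · exfalso
          have h1 : Y a * Y (a + 1) = 0 := by
            rw [← (hprod a).resolve_right fun h => hp h.1, hQa]
            ring
          have h2 : Q (a + (j - 1)) ≠ 0 := hmin (j - 1) (by omega) (by omega)
          have h3 := (hYne _ h2).2
          rw [show a + (j - 1) + 1 = a + j by omega, hY] at h3
          exact mul_ne_zero h3 hYa h1
    -- For `1 ≤ n ≤ j`, `z n` sits at vertex `a + n`; `z (j + 1)` vanishes because `Q (a + j)` does.
    obtain ⟨z, z0, z1, zs⟩ : ∃ z : ℕ → ℂ, z 0 = 0 ∧ z 1 = 1 ∧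
        ∀ n, z (n + 2) = s * (Q (a + n + 1) / Y (a + n + 1)) * z (n + 1) :=
      ⟨fun n => n.casesOn 0 fun n =>
        Nat.rec 1 (fun n w => s * (Q (a + n + 1) / Y (a + n + 1)) * w) n, rfl, rfl, fun _ => rfl⟩
    refine sq_mem_of_dirichlet (N := j + 1) (z := z) (by omega) (by omega) ?_ z0 (by simp [z1]) ?_
    · intro n hn
      rcases n with _ | n
      · have := hsum a
        rw [hQa, zero_add] at this
        rw [zs, z0, zero_add, z1, add_zero, this, div_self hYa]
        ring
      · rw [zs (n + 1), zs n]
        exact hstep (a + n + 1) (hmin (n + 1) (by omega) (by omega)) _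
    · obtain ⟨k, rfl⟩ : ∃ k, j = k + 1 := ⟨j - 1, by omega⟩
      rw [zs, add_assoc, hQj]
      simp

/-! ### The eigenvalue equations of the hypercycle. -/

/-- The edge `{i, i + 1}` of a cycle. -/
def cycleEdge (n : ℕ) (i : Fin (n + 3)) : (SimpleGraph.cycleGraph (n + 3)).edgeSet :=
  ⟨s(i, i + 1), by simp [SimpleGraph.cycleGraph_adj]⟩

theorem add_one_ne_self_fin (n : ℕ) (i : Fin (n + 3)) : i + 1 ≠ i := by
  simp

theorem add_one_add_one_ne_self_fin (n : ℕ) (i : Fin (n + 3)) : i + 1 + 1 ≠ i := by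
  rw [add_assoc, Ne, add_eq_left]
  intro h
  have := congrArg Fin.val h
  simp [Fin.val_add, Nat.mod_eq_of_lt (show 1 + 1 < n + 3 by omega)] at this

theorem cycleEdge_injective (n : ℕ) : Function.Injective (cycleEdge n) := by
  intro i j h
  have h' : s(i, i + 1) = s(j, j + 1) := congrArg Subtype.val h
  rw [Sym2.eq_iff] at h'
  rcases h' with ⟨h1, -⟩ | ⟨h1, h2⟩
  · exact h1
  · rw [h1] at h2
    exact absurd h2 (add_one_add_one_ne_self_fin n j)

theorem cycleEdge_surjective (n : ℕ) : Function.Surjective (cycleEdge n) := by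
  rintro ⟨e, he⟩
  induction e using Sym2.ind with
  | _ u v =>
    rw [SimpleGraph.mem_edgeSet, SimpleGraph.cycleGraph_adj] at he
    rcases he with h | h
    · refine ⟨v, Subtype.ext ?_⟩
      change s(v, v + 1) = s(u, v)
      rw [← h, add_sub_cancel, Sym2.eq_swap]
    · refine ⟨u, Subtype.ext ?_⟩
      change s(u, u + 1) = s(u, v)
      rw [← h, add_sub_cancel]

open Finset in
/-- The edge of the hypercycle obtained from `{i, i + 1}`. -/
def hypercycleEdge (n r : ℕ) (i : Fin (n + 3)) :
    Finset ((SimpleGraph.cycleGraph (n + 3)).PowerVertex r) :=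
  ({i, i + 1} : Finset _).disjSum ({cycleEdge n i} ×ˢ univ)

theorem hypercycleEdge_injective (n r : ℕ) : Function.Injective (hypercycleEdge n r) := by
  intro i j h
  refine cycleEdge_injective n (Subtype.ext ?_)
  have h' := (Finset.disjSum_inj.1 h).1
  refine Sym2.ext fun v => ?_
  have := congrArg (v ∈ ·) h'
  simpa [cycleEdge] using this

theorem card_hypercycleEdge (n : ℕ) {r : ℕ} (hr : 2 ≤ r) (i : Fin (n + 3)) :
    (hypercycleEdge n r i).card = r := by
  rw [hypercycleEdge, Finset.card_disjSum, Finset.card_pair (add_one_ne_self_fin n i).symm]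
  simp
  omega

theorem hypercycle_edgeSet (n r : ℕ) :
    (hypercycle (n + 3) r).edgeSet = Set.range fun i => (hypercycleEdge n r i : Set _) := by
  change Set.range _ = _
  rw [← (cycleEdge_surjective n).range_comp]
  congr 1
  funext i
  ext w
  rcases w with v | ⟨e, t⟩
  · simp [SimpleGraph.powerEdge, hypercycleEdge, cycleEdge]
  · simp [SimpleGraph.powerEdge, hypercycleEdge, eq_comm]

open Finset in
theorem hypercycle_apply_inl (n : ℕ) {r : ℕ} (hr : 2 ≤ r)
    (x : (SimpleGraph.cycleGraph (n + 3)).PowerVertex r → ℂ) (u : Fin (n + 3)) :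
    ((hypercycle (n + 3) r).adjTensor r).apply x (Sum.inl (u + 1)) =
      x (Sum.inl u) * ∏ t, x (Sum.inr (cycleEdge n u, t)) +
      x (Sum.inl (u + 1 + 1)) * ∏ t, x (Sum.inr (cycleEdge n (u + 1), t)) := by
  rw [Hypergraph.adjTensor_apply _ (by omega) (hypercycleEdge n r) (hypercycleEdge_injective n r)
    (card_hypercycleEdge n hr) (hypercycle_edgeSet n r), ← sum_filter]
  have hfil : univ.filter (fun i => (Sum.inl (u + 1) :
      (SimpleGraph.cycleGraph (n + 3)).PowerVertex r) ∈ hypercycleEdge n r i) = {u, u + 1} := by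
    ext i
    simp [hypercycleEdge, eq_comm, or_comm]
  have her : ∀ i v, (hypercycleEdge n r i).erase (Sum.inl v) =
      (({i, i + 1} : Finset _).erase v).disjSum ({cycleEdge n i} ×ˢ univ) := by
    intro i v
    ext w
    rcases w with w | w <;> simp [hypercycleEdge]
  have h1 : ({u, u + 1} : Finset (Fin (n + 3))).erase (u + 1) = {u} := by
    ext w
    simp
    grind [add_one_ne_self_fin]
  have h2 : ({u + 1, u + 1 + 1} : Finset (Fin (n + 3))).erase (u + 1) = {u + 1 + 1} := by
    ext w
    simp
  rw [hfil, sum_pair (add_one_ne_self_fin n u).symm, her, her, h1, h2, prod_disjSum,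
    prod_disjSum, prod_product, prod_product]
  simp

open Finset in
theorem hypercycle_apply_inr (n : ℕ) {r : ℕ} (hr : 2 ≤ r)
    (x : (SimpleGraph.cycleGraph (n + 3)).PowerVertex r → ℂ) (i : Fin (n + 3)) (t : Fin (r - 2)) :
    ((hypercycle (n + 3) r).adjTensor r).apply x (Sum.inr (cycleEdge n i, t)) =
      x (Sum.inl i) * x (Sum.inl (i + 1)) *
        ∏ t' ∈ univ.erase t, x (Sum.inr (cycleEdge n i, t')) := by
  rw [Hypergraph.adjTensor_apply _ (by omega) (hypercycleEdge n r) (hypercycleEdge_injective n r)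
    (card_hypercycleEdge n hr) (hypercycle_edgeSet n r), ← sum_filter]
  have hfil : univ.filter (fun j => (Sum.inr (cycleEdge n i, t) :
      (SimpleGraph.cycleGraph (n + 3)).PowerVertex r) ∈ hypercycleEdge n r j) = {i} := by
    ext j
    simp [hypercycleEdge, (cycleEdge_injective n).eq_iff, eq_comm]
  have her : (hypercycleEdge n r i).erase (Sum.inr (cycleEdge n i, t)) =
      ({i, i + 1} : Finset _).disjSum ({cycleEdge n i} ×ˢ univ.erase t) := by
    ext w
    rcases w with w | ⟨e, t'⟩
    · simp [hypercycleEdge]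
    · simp [hypercycleEdge]
  rw [hfil, sum_singleton, her, prod_disjSum, prod_pair (add_one_ne_self_fin n i).symm,
    prod_product]
  simp

/-! ### Passing between the equations on one edge and the reduced relation. -/

open Finset in
/-- The eigenvalue equations on one edge, with end values `A`, `B` and new-vertex values `b`. -/
theorem edge_eq_of_eigen {d : ℕ} (hd : 1 ≤ d) {c A B : ℂ} (hc : c ≠ 0) {b : Fin d → ℂ}
    (h : ∀ t, A * B * ∏ t' ∈ univ.erase t, b t' = c * b t ^ (d + 1)) :
    (A * B * (∏ t, b t) / c) ^ 2 * c ^ (d + 2) = A ^ (d + 2) * B ^ (d + 2) ∨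
      2 ≤ d ∧ A * B * (∏ t, b t) / c = 0 := by
  have hP : ∀ t, A * B * ∏ t, b t = c * b t ^ (d + 2) := fun t => by
    rw [← mul_prod_erase univ b (mem_univ t)]
    linear_combination b t * h t
  by_cases h0 : A * B * ∏ t, b t = 0
  · rcases hd.lt_or_eq with hd | rfl
    · exact Or.inr ⟨hd, by rw [h0, zero_div]⟩
    -- For `d = 1` the product over the other new vertices is empty, so a zero new vertex forces `A
    -- * B = 0`.
    · left
      have h1 := hP 0
      rw [h0, eq_comm, mul_eq_zero, or_iff_right hc] at h1
      have h2 := h 0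
      rw [pow_eq_zero_iff (by omega)] at h1
      simp [h1] at h2
      rw [h0, ← mul_pow]
      rcases h2 with h2 | h2 <;> simp [h2]
  · left
    have h1 : (A * B * ∏ t, b t) ^ d = c ^ d * (∏ t, b t) ^ (d + 2) := by
      calc (A * B * ∏ t, b t) ^ d = ∏ t : Fin d, c * b t ^ (d + 2) := by
            rw [← prod_congr rfl fun t _ => hP t]
            simp
        _ = _ := by rw [prod_mul_distrib, prod_pow]; simp
    refine mul_left_cancel₀ (pow_ne_zero d h0) ?_
    calc (A * B * ∏ t, b t) ^ d * ((A * B * (∏ t, b t) / c) ^ 2 * c ^ (d + 2))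
        = c ^ d * (A * B * ∏ t, b t) ^ (d + 2) := by
          generalize A * B * ∏ t, b t = P
          rw [div_pow, pow_add c]
          field_simp
          ring
      _ = c ^ d * (∏ t, b t) ^ (d + 2) * (A ^ (d + 2) * B ^ (d + 2)) := by
          rw [mul_pow (A * B), mul_pow A]
          ring
      _ = _ := by rw [← h1]

-- For `q ≠ 0`, giving every new vertex the same root `ρ` of `q` yields the edge product only up to
-- a root of unity `ζ`, which one new vertex absorbs. For `q = 0`, take all new vertices zero.
open Finset in
theorem exists_eigen_of_edge_eq {d : ℕ} (hd : 1 ≤ d) {c A B q : ℂ} (hc : c ≠ 0)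
    (hq : q ^ 2 * c ^ (d + 2) = A ^ (d + 2) * B ^ (d + 2) ∨ 2 ≤ d ∧ q = 0) :
    ∃ b : Fin d → ℂ, (∀ t, A * B * ∏ t' ∈ univ.erase t, b t' = c * b t ^ (d + 1)) ∧
      A * B * ∏ t, b t = c * q ∧ (q = 0 → ∏ t, b t = 0) := by
  have : NeZero d := ⟨by omega⟩
  by_cases h0 : q = 0
  · refine ⟨0, fun t => ?_, ?_, fun _ => ?_⟩
    · rcases hd.lt_or_eq with hd | rfl
      · have : (univ.erase t).Nonempty := by
          rw [← card_pos, card_erase_of_mem (mem_univ t)]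
          simp
          omega
        obtain ⟨t', ht'⟩ := this
        rw [prod_eq_zero ht' rfl]
        simp
      · have h1 := hq.resolve_right (by simp)
        rw [h0, ← mul_pow, zero_pow two_ne_zero, zero_mul, eq_comm, pow_eq_zero_iff (by omega)]
          at h1
        simp [h1]
    · simp [h0, NeZero.ne d]
    · simp [NeZero.ne d]
  · have h1 := hq.resolve_right fun h => h0 h.2
    obtain ⟨ρ, hρ⟩ := IsAlgClosed.exists_pow_nat_eq q (n := d + 2) (by omega)
    have hρ0 : ρ ≠ 0 := by
      rintro rfl
      exact h0 (by rw [← hρ, zero_pow (by omega)])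
    obtain ⟨ζ, hζ⟩ : ∃ ζ, ζ * (A * B * ρ ^ d) = c * q := by
      refine ⟨c * q / (A * B * ρ ^ d), div_mul_cancel₀ _ ?_⟩
      refine mul_ne_zero (fun h => ?_) (pow_ne_zero _ hρ0)
      rw [← mul_pow, h, zero_pow (by omega)] at h1
      exact mul_ne_zero (pow_ne_zero 2 h0) (pow_ne_zero _ hc) h1
    have hζ1 : ζ ^ (d + 2) = 1 := by
      have h2 : (A * B * ρ ^ d) ^ (d + 2) = (c * q) ^ (d + 2) := by
        rw [mul_pow, mul_pow A B, ← h1, ← pow_mul, mul_comm d, pow_mul, hρ]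
        ring
      refine mul_right_cancel₀ (pow_ne_zero (d + 2) (mul_ne_zero hc h0)) ?_
      rw [one_mul, ← h2, ← mul_pow, hζ, h2]
    obtain ⟨b, hbdef⟩ : ∃ b : Fin d → ℂ, b = fun t => if t = 0 then ζ * ρ else ρ := ⟨_, rfl⟩
    have hprod : ∏ t, b t = ζ * ρ ^ d := by
      have : ∀ t, b t = (if t = 0 then ζ else 1) * ρ := fun t => by
        rw [hbdef]
        split_ifs <;> simp_all
      rw [prod_congr rfl fun t _ => this t, prod_mul_distrib]
      simp
    have hbq : ∀ t, b t ^ (d + 2) = q := fun t => by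
      simp only [hbdef]
      split_ifs
      · rw [mul_pow, hζ1, one_mul, hρ]
      · exact hρ
    have hP : A * B * ∏ t, b t = c * q := by
      rw [hprod, ← hζ]
      ring
    refine ⟨b, fun t => ?_, hP, fun h => absurd h h0⟩
    have hb0 : b t ≠ 0 := fun h => h0 (by rw [← hbq t, h, zero_pow (by omega)])
    refine mul_left_cancel₀ hb0 ?_
    rw [← hbq t, ← mul_prod_erase univ b (mem_univ t)] at hP
    linear_combination hP

theorem ofNat_fin_add_self (n k : ℕ) : Fin.ofNat (n + 3) (k + (n + 3)) = Fin.ofNat (n + 3) k :=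
  Fin.ext (by simp)

theorem ofNat_fin_add_one (n k : ℕ) : Fin.ofNat (n + 3) (k + 1) = Fin.ofNat (n + 3) k + 1 :=
  Fin.ext (by simp [Fin.val_add])

open Finset in
/-- The `r`-th power of a nonzero eigenvalue of a hypercycle. -/
theorem pow_mem_of_isEigenpair {n d m : ℕ} (hd : 1 ≤ d)
    (hm : m = n + 3 ∨ ¬ 2 ≤ d ∧ m = n + 3 - 1) {c : ℂ} (hc : c ≠ 0)
    {x : (SimpleGraph.cycleGraph (n + 3)).PowerVertex (d + 2) → ℂ}
    (h : ((hypercycle (n + 3) (d + 2)).adjTensor (d + 2)).IsEigenpair c x) :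
    c ^ (d + 2) ∈ ({4} : Set ℂ) ∪ pathSquares m := by
  obtain ⟨hx, h⟩ := h
  have : NeZero d := ⟨by omega⟩
  have hr : ∀ (i : Fin (n + 3)) (t : Fin d), x (Sum.inl i) * x (Sum.inl (i + 1)) *
      ∏ t' ∈ univ.erase t, x (Sum.inr (cycleEdge n i, t')) =
      c * x (Sum.inr (cycleEdge n i, t)) ^ (d + 1) := fun i t =>
    (hypercycle_apply_inr n (by omega) x i t).symm.trans (h _)
  have hl : ∀ u : Fin (n + 3), x (Sum.inl u) * ∏ t : Fin d, x (Sum.inr (cycleEdge n u, t)) +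
      x (Sum.inl (u + 1 + 1)) * ∏ t : Fin d, x (Sum.inr (cycleEdge n (u + 1), t)) =
      c * x (Sum.inl (u + 1)) ^ (d + 1) := fun u =>
    (hypercycle_apply_inl n (by omega) x u).symm.trans (h _)
  obtain ⟨Q, hQ⟩ : ∃ Q : Fin (n + 3) → ℂ, ∀ i, Q i = x (Sum.inl i) * x (Sum.inl (i + 1)) *
      (∏ t : Fin d, x (Sum.inr (cycleEdge n i, t))) / c := ⟨_, fun _ => rfl⟩
  have hsum : ∀ u, Q u + Q (u + 1) = x (Sum.inl (u + 1)) ^ (d + 2) := by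
    intro u
    rw [hQ, hQ]
    field_simp
    linear_combination x (Sum.inl (u + 1)) * hl u
  refine sq_mem_of_cycle_solution (l := n + 3) (p := 2 ≤ d)
    (Y := fun k => x (Sum.inl (Fin.ofNat (n + 3) k)) ^ (d + 2))
    (Q := fun k => Q (Fin.ofNat (n + 3) k))
    (by omega) hm (pow_ne_zero _ hc) ?_ ?_ ?_ ?_ ?_
  · intro k
    simp only [ofNat_fin_add_self]
  · intro k
    simp only [ofNat_fin_add_self]
  · intro k
    simp only [ofNat_fin_add_one]
    exact hsum _
  · intro k
    simp only [ofNat_fin_add_one, hQ]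
    exact edge_eq_of_eigen hd hc (hr _)
  · by_contra! h0
    have h1 : ∀ i : Fin (n + 3), x (Sum.inl i) = 0 := fun i => by
      have := h0 i.val
      rw [Fin.ofNat_val_eq_self] at this
      exact pow_eq_zero_iff (by omega) |>.1 this
    refine hx (funext fun w => ?_)
    rcases w with v | ⟨e, t⟩
    · exact h1 v
    · obtain ⟨i, rfl⟩ := cycleEdge_surjective n e
      have := hr i t
      rw [h1, zero_mul, zero_mul, eq_comm, mul_eq_zero, or_iff_right hc] at this
      exact pow_eq_zero_iff (by omega) |>.1 this

/-! ### Construction of eigenvectors. -/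

open Finset in
theorem pow_mem_of_cycle_solution {n d : ℕ} (hd : 1 ≤ d) {μ : ℂ} (hμ : μ ≠ 0)
    {y q : Fin (n + 3) → ℂ} (hy : ∃ i, y i ≠ 0) (hsum : ∀ i, q i + q (i + 1) = y (i + 1))
    (hq : ∀ i, q i ^ 2 * μ = y i * y (i + 1) ∨ 2 ≤ d ∧ q i = 0) :
    μ ∈ (fun c : ℂ => c ^ (d + 2)) ''
      ((hypercycle (n + 3) (d + 2)).adjTensor (d + 2)).eigenvalues := by
  obtain ⟨c, rfl⟩ := IsAlgClosed.exists_pow_nat_eq μ (n := d + 2) (by omega)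
  have hc : c ≠ 0 := by
    rintro rfl
    exact hμ (zero_pow (by omega))
  choose a ha using fun i => IsAlgClosed.exists_pow_nat_eq (y i) (n := d + 2) (by omega)
  have hex : ∀ i, _ := fun i => exists_eigen_of_edge_eq (d := d) (A := a i) (B := a (i + 1))
    (q := q i) hd hc (by rw [ha, ha]; exact hq i)
  choose b hb1 hb2 hb3 using hex
  obtain ⟨inv, hinv⟩ : ∃ inv : (SimpleGraph.cycleGraph (n + 3)).edgeSet → Fin (n + 3), ∀ i,
      inv (cycleEdge n i) = i :=
    ⟨_, Function.leftInverse_invFun (cycleEdge_injective n)⟩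
  refine ⟨c, ⟨Sum.elim a fun p => b (inv p.1) p.2, ?_, ?_⟩, rfl⟩
  · obtain ⟨i, hi⟩ := hy
    intro h
    have := congrFun h (Sum.inl i)
    rw [Sum.elim_inl, Pi.zero_apply] at this
    exact hi (by rw [← ha, this, zero_pow (by omega)])
  · rintro (v | ⟨e, t⟩)
    · obtain ⟨u, rfl⟩ : ∃ u, v = u + 1 := ⟨v - 1, by simp⟩
      refine (hypercycle_apply_inl n (by omega) _ u).trans ?_
      simp only [Sum.elim_inl, Sum.elim_inr, hinv]
      change a u * ∏ t : Fin d, b u t + a (u + 1 + 1) * ∏ t : Fin d, b (u + 1) t =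
        c * a (u + 1) ^ (d + 1)
      -- At a zero vertex the equation cannot be recovered by cancelling `a (u + 1)`; there both
      -- adjacent `q` vanish, and with them the products over new vertices.
      by_cases h0 : a (u + 1) = 0
      · have hy0 : y (u + 1) = 0 := by rw [← ha, h0, zero_pow (by omega)]
        have h1 : q u = 0 := by
          rcases hq u with h | h
          · rw [hy0, mul_zero, mul_eq_zero, or_iff_left hμ] at h
            exact pow_eq_zero_iff two_ne_zero |>.1 h
          · exact h.2
        have h2 : q (u + 1) = 0 := by
          have := hsum u
          rwa [h1, hy0, zero_add] at this
        rw [hb3 _ h1, hb3 _ h2, h0, zero_pow (by omega)]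
        ring
      · refine mul_left_cancel₀ h0 ?_
        have h1 := hsum u
        rw [← ha] at h1
        linear_combination hb2 u + hb2 (u + 1) + c * h1
    · obtain ⟨i, rfl⟩ := cycleEdge_surjective n e
      refine (hypercycle_apply_inr n (by omega) _ i t).trans ?_
      simp only [Sum.elim_inl, Sum.elim_inr, hinv]
      exact hb1 i t

/-- The indicator of one cycle vertex works: an edge has at least three vertices, so omitting one
still leaves a zero factor. -/
theorem zero_mem_pow_eigenvalues {n d : ℕ} (hd : 1 ≤ d) :
    0 ∈ (fun c : ℂ => c ^ (d + 2)) ''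
      ((hypercycle (n + 3) (d + 2)).adjTensor (d + 2)).eigenvalues := by
  have : NeZero d := ⟨by omega⟩
  refine ⟨0, ⟨Sum.elim (Pi.single 0 1) 0, ?_, ?_⟩, zero_pow (by omega)⟩
  · intro h
    have := congrFun h (Sum.inl 0)
    simp at this
  · rintro (v | ⟨e, t⟩)
    · obtain ⟨u, rfl⟩ : ∃ u, v = u + 1 := ⟨v - 1, by simp⟩
      refine (hypercycle_apply_inl n (by omega) _ u).trans ?_
      simp [NeZero.ne d]
    · obtain ⟨i, rfl⟩ := cycleEdge_surjective n e
      refine (hypercycle_apply_inr n (by omega) _ i t).trans ?_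
      have : (Pi.single 0 1 : Fin (n + 3) → ℂ) i *
          (Pi.single 0 1 : Fin (n + 3) → ℂ) (i + 1) = 0 := by
        by_cases h : i = 0
        · subst h
          simp
        · simp [h]
      simp only [Sum.elim_inl, this, zero_mul]

theorem four_mem_pow_eigenvalues {n d : ℕ} (hd : 1 ≤ d) :
    4 ∈ (fun c : ℂ => c ^ (d + 2)) ''
      ((hypercycle (n + 3) (d + 2)).adjTensor (d + 2)).eigenvalues :=
  pow_mem_of_cycle_solution hd (by norm_num) (y := fun _ => 1) (q := fun _ => 1 / 2)
    ⟨0, one_ne_zero⟩ (fun _ => by norm_num) fun _ => Or.inl (by norm_num)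

/-- The sine eigenvector of a path on `j` vertices is laid along the cycle and the closing edge gets
weight zero. For `j = l` that edge has nonzero ends, which requires `2 ≤ d`. -/
theorem pathSquares_subset_pow_eigenvalues {n d m : ℕ} (hd : 1 ≤ d)
    (hm : m = n + 3 ∧ 2 ≤ d ∨ m = n + 3 - 1) :
    pathSquares m ⊆ (fun c : ℂ => c ^ (d + 2)) ''
      ((hypercycle (n + 3) (d + 2)).adjTensor (d + 2)).eigenvalues := by
  rintro _ ⟨j, hj, k, hk, rfl⟩
  rw [Finset.mem_Icc] at hj hk
  obtain ⟨θ, hθ⟩ : ∃ θ : ℝ, θ = (k : ℝ) * Real.pi / ((j : ℝ) + 1) := ⟨_, rfl⟩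
  obtain ⟨s, hs⟩ : ∃ s : ℝ, s = 2 * Real.cos θ := ⟨_, rfl⟩
  rw [← hθ, ← hs]
  by_cases hs0 : s = 0
  · rw [hs0]
    simpa using zero_mem_pow_eigenvalues hd
  have hsC : (s : ℂ) ≠ 0 := by exact_mod_cast hs0
  obtain ⟨z, hz⟩ : ∃ z : ℕ → ℝ, ∀ i, z i = if i ≤ j then Real.sin (i * θ) else 0 :=
    ⟨_, fun _ => rfl⟩
  have hz0 : z 0 = 0 := by simp [hz]
  have hsin : Real.sin ((j + 1) * θ) = 0 := by
    rw [hθ, mul_div_cancel₀ _ (by positivity), Real.sin_nat_mul_pi]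
  have hz1 : z 1 ≠ 0 := by
    rw [hz, if_pos hj.1, Nat.cast_one, one_mul, hθ]
    refine (Real.sin_pos_of_pos_of_lt_pi ?_ ?_).ne'
    · have : (1 : ℝ) ≤ k := by exact_mod_cast hk.1
      positivity
    · rw [div_lt_iff₀ (by positivity), mul_comm]
      gcongr
      exact_mod_cast Nat.lt_succ_of_le hk.2
  -- The factor `z (i + 1)` keeps the relation valid beyond `j`, where `z` is cut off; at `i + 1 =
  -- j` the cut agrees with `sin ((j + 1) θ) = 0`.
  have hzs : ∀ i, z (i + 1) * (z i + z (i + 2)) = s * z (i + 1) ^ 2 := by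
    intro i
    by_cases h : i + 1 ≤ j
    · have h2 : z (i + 2) = Real.sin ((i + 2 : ℕ) * θ) := by
        rw [hz]
        split_ifs with h'
        · rfl
        · obtain rfl : j = i + 1 := by omega
          rw [← hsin]
          push_cast
          ring_nf
      have h3 : z i + z (i + 2) = s * z (i + 1) := by
        rw [h2, hz, hz, if_pos h, if_pos (by omega), hs]
        push_cast
        rw [show (i : ℝ) * θ = (i + 1) * θ - θ by ring,
          show ((i : ℝ) + 2) * θ = (i + 1) * θ + θ by ring, Real.sin_sub, Real.sin_add]
        ring
      rw [h3]
      ring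
    · rw [hz (i + 1), if_neg h]
      ring
  have hlast : ∀ i, n + 3 ≤ i → z (i + 1) = 0 := fun i hi => by
    rw [hz, if_neg (by omega)]
  have hval : ∀ i : Fin (n + 3), i ≠ Fin.last (n + 2) → (i + 1).val = i.val + 1 := fun i hi =>
    Fin.val_add_one_of_lt (lt_of_le_of_ne (Fin.le_last i) hi)
  refine pow_mem_of_cycle_solution hd (by exact_mod_cast pow_ne_zero 2 hs0)
    (y := fun i => (z (i.val + 1) : ℂ) ^ 2)
    (q := fun i => if i = Fin.last (n + 2) then 0 else (z (i.val + 1) * z (i.val + 2) / s : ℂ))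
    ⟨0, by simpa using hz1⟩ ?_ ?_
  · intro i
    have hz' : ∀ i : ℕ, (z (i + 1) * (z i + z (i + 2)) : ℂ) = s * z (i + 1) ^ 2 := fun i => by
      exact_mod_cast hzs i
    by_cases hi : i = Fin.last (n + 2)
    · subst hi
      have h0 : (0 : Fin (n + 3)) ≠ Fin.last (n + 2) := by simp [Fin.ext_iff]
      rw [if_pos rfl, Fin.last_add_one, if_neg h0]
      have := hz' 0
      rw [hz0, Complex.ofReal_zero] at this
      simp only [Fin.val_zero, zero_add] at this ⊢
      field_simp
      linear_combination this
    · rw [if_neg hi, hval i hi]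
      have := hz' (i.val + 1)
      by_cases hi' : i + 1 = Fin.last (n + 2)
      · rw [if_pos hi']
        have h1 : i.val + 1 = n + 2 := by rw [← hval i hi, hi']; rfl
        rw [hlast (i.val + 1 + 1) (by omega), Complex.ofReal_zero] at this
        field_simp
        linear_combination this
      · rw [if_neg hi']
        field_simp
        linear_combination this
  · intro i
    by_cases hi : i = Fin.last (n + 2)
    · subst hi
      rcases hm with ⟨-, hd2⟩ | hm
      · exact Or.inr ⟨hd2, if_pos rfl⟩
      · left
        rw [if_pos rfl, Fin.val_last, hz (n + 2 + 1), if_neg (by omega)]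
        simp
    · left
      rw [if_neg hi, hval i hi]
      push_cast
      field_simp

/-- The powers of the eigenvalues of a hypercycle. -/
theorem pow_eigenvalues_hypercycle {n d m : ℕ} (hd : 1 ≤ d)
    (hm : m = n + 3 ∧ 2 ≤ d ∨ ¬ 2 ≤ d ∧ m = n + 3 - 1) :
    (fun c : ℂ => c ^ (d + 2)) ''
      ((hypercycle (n + 3) (d + 2)).adjTensor (d + 2)).eigenvalues = {4} ∪ pathSquares m := by
  refine Set.Subset.antisymm ?_ (Set.union_subset ?_ ?_)
  · rintro _ ⟨c, ⟨x, hx⟩, rfl⟩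
    by_cases hc : c = 0
    · right
      -- Zero is the value `2 cos (π / 2)` of the one-vertex path.
      refine ⟨1, Finset.mem_Icc.2 ⟨le_rfl, by omega⟩, 1, by simp, ?_⟩
      rw [hc, show ((1 : ℕ) : ℝ) * Real.pi / ((1 : ℕ) + 1) = Real.pi / 2 by norm_num]
      simp
    · exact pow_mem_of_isEigenpair hd (hm.imp_left And.left) hc hx
  · exact Set.singleton_subset_iff.2 (four_mem_pow_eigenvalues hd)
  · exact pathSquares_subset_pow_eigenvalues hd (hm.imp_right And.right)

theorem mainTheorem10 (l : ℕ) (hl : 3 ≤ l) :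
    (∀ r : ℕ, 4 ≤ r →
      (fun μ : ℂ => μ ^ r) '' ((hypercycle l r).adjTensor r).eigenvalues
        = {4} ∪ pathSquares l) ∧
    (fun μ : ℂ => μ ^ 3) '' ((hypercycle l 3).adjTensor 3).eigenvalues
        = {4} ∪ pathSquares (l - 1) := by
  obtain ⟨n, rfl⟩ : ∃ n, l = n + 3 := ⟨l - 3, by omega⟩
  refine ⟨fun r hr => ?_, pow_eigenvalues_hypercycle (d := 1) le_rfl (Or.inr ⟨by omega, rfl⟩)⟩
  obtain ⟨d, rfl⟩ : ∃ d, r = d + 2 := ⟨r - 2, by omega⟩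
  exact pow_eigenvalues_hypercycle (by omega) (Or.inl ⟨rfl, by omega⟩)
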